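/- **Setting.** Let $\Omega,\Omega_0\subset\mathbb R$ be compact, $\Omega\neq\emptyset$, and let $\mathbb Q$ be a probability measure supported in $\Omega_0$ (the limiting empirical distribution of the signal $x^0$). An *inference task* $(g_0,g)$ consists of a reference measure $dy$ for the data, an open neighbourhood $U$ of $0$, a log-likelihood $g_0(y,w)$ with $\int e^{g_0(y,w)}dy=1$ for $w\in U$, and a pseudo-likelihood $g(y,w)$; both are measurable on $\mathbb R\times U$ and $C^3$ in $w\in U$, and for $f\in\{g_0,g\}$ $$\int e^{f(y,0)}dy<\infty,\quad \int|\partial_wf(y,0)|^4e^{g_0(y,0)}dy<\infty,\quad \|\partial_w^2f(\cdot,0)\|_\infty<\infty,\quad \|\partial_w^3f\|_{L^\infty(\mathbb R\times U)}<\infty .$$ Let $\mathbb P_0=e^{g_0(y,0)}dy$. The information parameters $\bar\beta=\bar\beta(g_0,g)$ are $$\beta_1=\operatorname{Var}_{\mathbb P_0}[\partial_wg(Y,0)],\quad \beta_2=\mathbb E_{\mathbb P_0}[\partial_wg(Y,0)\,\partial_wg_0(Y,0)],\quad \beta_3=-\mathbb E_{\mathbb P_0}[\partial_w^2g(Y,0)],\quad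 \beta_4=\mathbb E_{\mathbb P_0}[\partial_wg(Y,0)],$$ and the task is *ill-scored* if $\beta_4\ne0$. For $S\ge 0$ let $\gamma=m(t)\,dt+c\,\delta_S$ range over the finite measures on $[0,S]$ with $m\ge0$ nondecreasing and $c\ge0$. For $\lambda,\mu,x^0\in\mathbb R$ let $\Phi^{x^0}_{\gamma,\lambda,\mu}$ be the weak solution (continuous on $[0,S]\times\mathbb R$, with bounded weak derivative $\partial_y\Phi$) of $$\partial_t\Phi=-\tfrac{\beta_1}{2}\bigl(\partial_y^2\Phi+m(t)(\partial_y\Phi)^2\bigr),\qquad \Phi(S,y)=\max_{x\in\Omega}\Bigl(yx+\lambda xx^0+\bigl(\mu+\tfrac{\beta_1}{2}c\bigr)x^2\Bigr).$$ For a correction parameter $\alpha\in\mathbb R$ let, with values in the extended reals, $$\psi_{\bar\beta,\alpha}(S,M,v)=\inf_{\mu,\lambda,\rho,\gamma}\Bigl(\mathbb E_{x^0\sim\mathbb Q}[\Phi^{x^0}_{\gamma,\lambda,\mu}(0,\rho)]-\tfrac{\beta_1}{2}\int t\,d\gamma(t)-\mu S-\lambda M-\rho v\Bigr)+\tfrac{\beta_2M^2}{2}-\tfrac{\beta_3S^2}{4}-\tfrac{\beta_2(\mathbb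 E_{\mathbb Q}x^0)^2v^2}{2}+\tfrac{\alpha v^2}{2}.$$ Let $\mathcal C_-$ be the set of $(S,M,v)\in\mathbb R^3$ such that for all $\rho,\tau,\eta\in[-1,1]$ $$\mathbb E_{\mathbb Q}\Bigl[\inf_{x\in\Omega}(\rho x^2+\tau xx^0+\eta x)\Bigr]\le\rho S+\tau M+\eta v\le\mathbb E_{\mathbb Q}\Bigl[\sup_{x\in\Omega}(\rho x^2+\tau xx^0+\eta x)\Bigr],$$ and let $\mathcal C_{\bar\beta,\alpha}=\operatorname{argmax}_{\mathcal C_-}\psi_{\bar\beta,\alpha}$. Two tasks with information parameters $\bar\beta^1,\bar\beta^2$ and correction parameters $\alpha^1,\alpha^2$ are *coarsely equivalent* if $\mathcal C_{\bar\beta^1,\alpha^1}=\mathcal C_{\bar\beta^2,\alpha^2}$. **Theorem.** Let $(g_0^1,g^1)$ and $(g_0^2,g^2)$ be two ill-scored inference tasks with information parameters $\bar\beta^1,\bar\beta^2$, and let $\alpha^1,\alpha^2\in\mathbb R$ be correction parameters. Suppose that at least one of the following holds. 1. All ratios coincide: $$\frac{\sqrt{\beta_1^1}}{\sqrt{\beta_1^2}}=\frac{\beta_2^1}{\beta_2^2}=\frac{\beta_3^1}{\beta_3^2}=\frac{\beta_4^1}{\beta_4^2}=\frac{\alpha^1}{\alpha^2}.$$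 2. There is a constant $C$ with $|x|=C$ for every $x\in\Omega$, and $$\frac{\sqrt{\beta_1^1}}{\sqrt{\beta_1^2}}=\frac{\beta_2^1}{\beta_2^2}=\frac{\beta_4^1}{\beta_4^2}=\frac{\alpha^1}{\alpha^2}.$$ Here equality of the ratios means that there is a common factor $r>0$ such that each numerator is $r$ times its denominator (so a pair of vanishing entries is allowed). Then the two tasks with correction parameters $\alpha^1$ and $\alpha^2$ are coarsely equivalent. -/

import Mathlib

open MeasureTheory Set
open scoped ContDiff

noncomputable section

namespace PMLE

/-! ### Inference tasks and information parameters -/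

/-- The regularity class `F₀(dy)` for a pair `(f₁, f₂)` with domain `ℝ × U`. The reference measure
`dy` carries the data domain (it is Lebesgue or counting measure restricted to that domain in the
usual examples), and sup-norms in `y` are essential suprema with respect to it. -/
structure MemF0 (dy : Measure ℝ) (U : Set ℝ) (f : Fin 2 → ℝ → ℝ → ℝ) : Prop where
  measurable : ∀ i, Measurable (fun p : ℝ × U => f i p.1 p.2)
  contDiffOn : ∀ i y, ContDiffOn ℝ 3 (f i y) U
  exp_integrable : ∀ i, Integrable (fun y => Real.exp (f i y 0)) dy
  score_fourth_moment : ∀ i,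
    Integrable (fun y => |deriv (f i y) 0| ^ 4 * Real.exp (f 0 y 0)) dy
  second_deriv_bounded : ∀ i, ∃ K : ℝ, ∀ᵐ y ∂dy, |iteratedDeriv 2 (f i y) 0| ≤ K
  third_deriv_bounded : ∀ i, ∃ K : ℝ, ∀ᵐ y ∂dy, ∀ w ∈ U, |iteratedDeriv 3 (f i y) w| ≤ K

/-- An inference task: a log-likelihood `g₀(y, w) = log P_Y(Y = y | w)` (a log-density with respect
to `dy`) and a pseudo-likelihood `g(y, w)`, with `(g₀, g) ∈ F₀(dy)`. -/
structure InferenceTask where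
  /-- reference measure for the data -/
  dy : Measure ℝ
  /-- neighbourhood of `0` on which the parameter `w` lives -/
  U : Set ℝ
  isOpen_U : IsOpen U
  zero_mem_U : (0 : ℝ) ∈ U
  /-- log-likelihood -/
  g₀ : ℝ → ℝ → ℝ
  /-- pseudo-likelihood -/
  g : ℝ → ℝ → ℝ
  isLogDensity : ∀ w ∈ U, ∫⁻ y, ENNReal.ofReal (Real.exp (g₀ y w)) ∂dy = 1
  regular : MemF0 dy U ![g₀, g]

/-- The law `P₀` of a data entry under the null model `w = 0`. -/
def InferenceTask.nullMeasure (T : InferenceTask) : Measure ℝ :=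
  T.dy.withDensity (fun y => ENNReal.ofReal (Real.exp (T.g₀ y 0)))

/-- A vector `(β₁, β₂, β₃, β₄)`. -/
structure InfoParams where
  β₁ : ℝ
  β₂ : ℝ
  β₃ : ℝ
  β₄ : ℝ

/-- The information parameters of an inference task. -/
def InferenceTask.infoParams (T : InferenceTask) : InfoParams where
  β₁ := ∫ y, (deriv (T.g y) 0 - ∫ z, deriv (T.g z) 0 ∂T.nullMeasure) ^ 2 ∂T.nullMeasure
  β₂ := ∫ y, deriv (T.g y) 0 * deriv (T.g₀ y) 0 ∂T.nullMeasure
  β₃ := -∫ y, iteratedDeriv 2 (T.g y) 0 ∂T.nullMeasure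
  β₄ := ∫ y, deriv (T.g y) 0 ∂T.nullMeasure

/-- The task is ill-scored: the score parameter `β₄` does not vanish. -/
def InferenceTask.IllScored (T : InferenceTask) : Prop := T.infoParams.β₄ ≠ 0

/-! ### The zero-temperature Parisi functional -/

/-- Test functions: smooth with compact support inside `(0, S) × ℝ`. -/
structure IsTestFunction (S : ℝ) (φ : ℝ → ℝ → ℝ) : Prop where
  smooth : ContDiff ℝ ∞ (fun p : ℝ × ℝ => φ p.1 p.2)
  hasCompactSupport : HasCompactSupport (fun p : ℝ × ℝ => φ p.1 p.2)
  tsupport_subset : tsupport (fun p : ℝ × ℝ => φ p.1 p.2) ⊆ Ioo 0 S ×ˢ univ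

/-- `Φ` is the weak solution on `[0, S] × ℝ` of the backward Hamilton-Jacobi-Bellman equation
`∂ₜΦ = -(β₁/2) (∂²_y Φ + m(t) (∂_y Φ)²)` with terminal value `Φ(S, ·) = h`:
`Φ` is continuous, has a bounded weak derivative `u = ∂_y Φ`, attains its terminal value, and
satisfies the equation against every test function. The coefficient `β₁ / 2` is `ξ'' / 2` for
`ξ(t) = β₁ t² / 2`, where `N ξ(R)` is (to leading order) the covariance of the Gaussian objective
`√β₁ N^(-1/2) ∑_{i ≤ j} g_{ij} x_i x_j` at overlap `R`. -/
structure IsWeakSolution (β₁ S : ℝ) (m h : ℝ → ℝ) (Φ : ℝ → ℝ → ℝ) : Prop where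
  continuousOn : ContinuousOn (fun p : ℝ × ℝ => Φ p.1 p.2) (Icc 0 S ×ˢ univ)
  terminal : ∀ y, Φ S y = h y
  equation : ∃ u : ℝ → ℝ → ℝ, Measurable (fun p : ℝ × ℝ => u p.1 p.2) ∧
    (∃ K, ∀ t y, |u t y| ≤ K) ∧
    (∀ φ, IsTestFunction S φ →
      ∫ t in Ioo 0 S, ∫ y, Φ t y * deriv (φ t) y = -∫ t in Ioo 0 S, ∫ y, u t y * φ t y) ∧
    (∀ φ, IsTestFunction S φ →
      ∫ t in Ioo 0 S, ∫ y,
        (-(Φ t y * deriv (fun s => φ s y) t)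
          + β₁ / 2 * (Φ t y * iteratedDeriv 2 (φ t) y + m t * u t y ^ 2 * φ t y)) = 0)

/-- `(m, c)` parametrizes an element `m(s) ds + c δ_S` of `A_S`: a finite measure on `[0, S]` with
`m ≥ 0` nondecreasing and `c ≥ 0`. -/
structure IsAdmissible (S : ℝ) (m : ℝ → ℝ) (c : ℝ) : Prop where
  nonneg : ∀ t ∈ Ico 0 S, 0 ≤ m t
  monotoneOn : MonotoneOn m (Ico 0 S)
  integrableOn : IntegrableOn m (Ico 0 S)
  atom_nonneg : 0 ≤ c

/-- The measure `γ = m(s) ds + c δ_S` on `[0, S]`. -/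
def parisiMeasure (S : ℝ) (m : ℝ → ℝ) (c : ℝ) : Measure ℝ :=
  (volume.restrict (Ico 0 S)).withDensity (fun t => ENNReal.ofReal (m t))
    + ENNReal.ofReal c • Measure.dirac S

/-- The terminal value `max_{x ∈ Ω} (y x + l x x⁰ + (μ + β₁ c / 2) x²)`. -/
def terminalValue (Ω : Set ℝ) (β₁ c l μ x₀ y : ℝ) : ℝ :=
  sSup ((fun x => y * x + l * x * x₀ + (μ + β₁ / 2 * c) * x ^ 2) '' Ω)

/-- The functional `ψ_{β,-}(S, M, v)`, an infimum in the extended reals over the multipliers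
`μ, l, ρ` and `γ = m ds + c δ_S`. Here `Φ x₀` is the weak solution of the Hamilton-Jacobi-Bellman
equation whose terminal value has signal value `x₀`. -/
def psiMinus (Ω : Set ℝ) (Q : Measure ℝ) (β : InfoParams) (S M v : ℝ) : EReal :=
  sInf {a : EReal | ∃ (μ l ρ c : ℝ) (m : ℝ → ℝ) (Φ : ℝ → ℝ → ℝ → ℝ),
    IsAdmissible S m c ∧
    (∀ x₀, IsWeakSolution β.β₁ S m (terminalValue Ω β.β₁ c l μ x₀) (Φ x₀)) ∧
    a = (((∫ x₀, Φ x₀ 0 ρ ∂Q) - β.β₁ / 2 * (∫ t, t ∂parisiMeasure S m c)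
          - μ * S - l * M - ρ * v + β.β₂ * M ^ 2 / 2 - β.β₃ * S ^ 2 / 4 : ℝ) : EReal)}

/-- The functional `ψ_{β,α}` of the score-corrected problem with correction parameter `α`. -/
def psiCorrected (Ω : Set ℝ) (Q : Measure ℝ) (β : InfoParams) (α : ℝ) (S M v : ℝ) : EReal :=
  psiMinus Ω Q β S M v
    + ((-(β.β₂ * (∫ x₀, x₀ ∂Q) ^ 2 * v ^ 2 / 2) + α * v ^ 2 / 2 : ℝ) : EReal)

/-- The domain `C_-` of triples `(S, M, v)`. -/
def domainMinus (Ω : Set ℝ) (Q : Measure ℝ) : Set (ℝ × ℝ × ℝ) :=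
  {p | ∀ ρ ∈ Icc (-1 : ℝ) 1, ∀ τ ∈ Icc (-1 : ℝ) 1, ∀ η ∈ Icc (-1 : ℝ) 1,
    (∫ x₀, sInf ((fun x => ρ * x ^ 2 + τ * x * x₀ + x * η) '' Ω) ∂Q)
        ≤ ρ * p.1 + τ * p.2.1 + η * p.2.2 ∧
    ρ * p.1 + τ * p.2.1 + η * p.2.2
        ≤ ∫ x₀, sSup ((fun x => ρ * x ^ 2 + τ * x * x₀ + x * η) '' Ω) ∂Q}

/-- The set `C_{β,α}` of maximizers of `ψ_{β,α}` over `C_-`. -/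
def correctedMaximizers (Ω : Set ℝ) (Q : Measure ℝ) (β : InfoParams) (α : ℝ) :
    Set (ℝ × ℝ × ℝ) :=
  {p | p ∈ domainMinus Ω Q ∧ ∀ q ∈ domainMinus Ω Q,
    psiCorrected Ω Q β α q.1 q.2.1 q.2.2 ≤ psiCorrected Ω Q β α p.1 p.2.1 p.2.2}

/-- Coarse equivalence of two inference tasks with correction parameters, for the parameter set `Ω`
and the limiting signal distribution `Q`: the sets of optimal overlaps coincide. -/
def CoarselyEquivalent (Ω : Set ℝ) (Q : Measure ℝ) (T₁ : InferenceTask) (α₁ : ℝ)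
    (T₂ : InferenceTask) (α₂ : ℝ) : Prop :=
  correctedMaximizers Ω Q T₁.infoParams α₁ = correctedMaximizers Ω Q T₂.infoParams α₂

end PMLE

end

noncomputable section

namespace PMLE

/-! The Parisi functional has a scaling symmetry. If `Φ` solves the equation for `r²b` and `m`, then
`r⁻¹ Φ(t, r y)` solves it for `b` and `r m`. Sending `(μ, l, ρ, γ)` to `(r⁻¹μ, r⁻¹l, r⁻¹ρ, rγ)` then
matches the competitors in the two infima and multiplies the objective by `r⁻¹`. Hence `ψ_{β,α} = r
ψ_{β',α'} + (r β₃' - β₃) S²/4` (`psiCorrected_rescale`). A positive factor does not move maximizers.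
The remainder vanishes when the `β₃` scale too, and is constant on `C_-` when `|x| = C` on `Ω`,
since then `S = C²`. The score `β₄` does not enter `ψ`. -/

/-- The rescaling `φ(t, k y)` of a test function is a test function. -/
theorem IsTestFunction.comp_mul_left {S : ℝ} {φ : ℝ → ℝ → ℝ} (hφ : IsTestFunction S φ)
    {k : ℝ} (hk : k ≠ 0) : IsTestFunction S (fun t y => φ t (k * y)) := by
  let e : ℝ × ℝ ≃ₜ ℝ × ℝ := (Homeomorph.refl ℝ).prodCongr (Homeomorph.mulLeft₀ k hk)
  have he : (fun p : ℝ × ℝ => φ p.1 (k * p.2)) = (fun p : ℝ × ℝ => φ p.1 p.2) ∘ e := rfl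
  refine ⟨?_, ?_, ?_⟩
  · have := hφ.smooth
    exact this.comp (contDiff_fst.prodMk (contDiff_const.mul contDiff_snd))
  · rw [he]
    exact hφ.hasCompactSupport.comp_homeomorph e
  · rw [he, tsupport_comp_eq_preimage _ e]
    intro p hp
    exact ⟨(hφ.tsupport_subset hp).1, mem_univ _⟩

/-- Scaling covariance of the weak Hamilton-Jacobi-Bellman equation. -/
theorem IsWeakSolution.rescale {b S r : ℝ} {m h : ℝ → ℝ} {Φ : ℝ → ℝ → ℝ} (hr : 0 < r)
    (H : IsWeakSolution (r ^ 2 * b) S m h Φ) :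
    IsWeakSolution b S (fun t => r * m t) (fun y => r⁻¹ * h (r * y))
      (fun t y => r⁻¹ * Φ t (r * y)) := by
  have hr0 : r ≠ 0 := hr.ne'
  have habs : |r⁻¹| = r⁻¹ := abs_of_pos (inv_pos.2 hr)
  refine ⟨?_, fun y => by rw [H.terminal], ?_⟩
  · refine continuousOn_const.mul (H.continuousOn.comp (f := fun p : ℝ × ℝ => (p.1, r * p.2))
      (by fun_prop) ?_)
    exact fun p hp => ⟨hp.1, mem_univ _⟩
  obtain ⟨u, hum, ⟨K, hK⟩, h₁, h₂⟩ := H.equation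
  refine ⟨fun t y => u t (r * y), ?_, ⟨K, fun t y => hK t _⟩, fun φ hφ => ?_, fun φ hφ => ?_⟩
  · exact hum.comp (measurable_fst.prodMk (measurable_snd.const_mul r))
  · have key := h₁ _ (hφ.comp_mul_left (inv_ne_zero hr0))
    have hL : ∀ t, ∫ y, r⁻¹ * Φ t (r * y) * deriv (φ t) y
        = r⁻¹ * ∫ z, Φ t z * deriv (fun y => φ t (r⁻¹ * y)) z := by
      intro t
      rw [← habs, ← smul_eq_mul (|r⁻¹|), ← Measure.integral_comp_mul_left]
      congr 1; ext y
      rw [habs, deriv_comp_mul_left, inv_mul_cancel_left₀ hr0, smul_eq_mul]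
      ring
    have hR : ∀ t, ∫ y, u t (r * y) * φ t y = r⁻¹ * ∫ z, u t z * φ t (r⁻¹ * z) := by
      intro t
      rw [← habs, ← smul_eq_mul (|r⁻¹|), ← Measure.integral_comp_mul_left]
      congr 1; ext y
      rw [habs, inv_mul_cancel_left₀ hr0]
    simp only [hL, hR, integral_const_mul]
    rw [key, mul_neg]
  · have key := h₂ _ (hφ.comp_mul_left (inv_ne_zero hr0))
    have hI : ∀ t, ∫ y, (-(r⁻¹ * Φ t (r * y) * deriv (fun s => φ s y) t)
          + b / 2 * (r⁻¹ * Φ t (r * y) * iteratedDeriv 2 (φ t) y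
            + r * m t * u t (r * y) ^ 2 * φ t y))
        = r⁻¹ * (r⁻¹ * ∫ z, (-(Φ t z * deriv (fun s => φ s (r⁻¹ * z)) t)
          + r ^ 2 * b / 2 * (Φ t z * iteratedDeriv 2 (fun y => φ t (r⁻¹ * y)) z
            + m t * u t z ^ 2 * φ t (r⁻¹ * z)))) := by
      intro t
      -- Of the two outer factors `r⁻¹`, the inner one is the Jacobian of `z = r y`; the other is
      -- left over because every term of the equation scales alike.
      nth_rewrite 4 [← habs]
      rw [← smul_eq_mul (|r⁻¹|), ← Measure.integral_comp_mul_left, ← integral_const_mul]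
      congr 1; ext y
      have hd : iteratedDeriv 2 (fun y => φ t (r⁻¹ * y)) (r * y)
          = r⁻¹ ^ 2 * iteratedDeriv 2 (φ t) y := by
        have h' : deriv (fun y => φ t (r⁻¹ * y)) = fun y => r⁻¹ * deriv (φ t) (r⁻¹ * y) := by
          ext z; rw [deriv_comp_mul_left, smul_eq_mul]
        simp only [iteratedDeriv_succ, iteratedDeriv_zero]
        rw [h', deriv_const_mul_field, deriv_comp_mul_left, inv_mul_cancel_left₀ hr0, smul_eq_mul]
        ring
      rw [hd, inv_mul_cancel_left₀ hr0]
      field_simp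
    simp only [hI, integral_const_mul]
    rw [key]; simp

/-- The atom scales like the density `m`: `r⁻¹ (r²b/2) c = (b/2)(r c)`. -/
theorem terminalValue_rescale (Ω : Set ℝ) {r : ℝ} (hr : 0 < r) (b c l μ x₀ y : ℝ) :
    r⁻¹ * terminalValue Ω (r ^ 2 * b) c l μ x₀ (r * y)
      = terminalValue Ω b (r * c) (r⁻¹ * l) (r⁻¹ * μ) x₀ y := by
  unfold terminalValue
  rw [← smul_eq_mul, ← Real.sSup_smul_of_nonneg (inv_pos.2 hr).le, ← image_smul, image_image]
  congr 2; ext x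
  simp only [smul_eq_mul]
  field_simp

theorem IsAdmissible.const_mul {S c r : ℝ} {m : ℝ → ℝ} (hr : 0 ≤ r) (H : IsAdmissible S m c) :
    IsAdmissible S (fun t => r * m t) (r * c) where
  nonneg t ht := mul_nonneg hr (H.nonneg t ht)
  monotoneOn _ hs _ ht hst := mul_le_mul_of_nonneg_left (H.monotoneOn hs ht hst) hr
  integrableOn := H.integrableOn.const_mul r
  atom_nonneg := mul_nonneg hr H.atom_nonneg

theorem parisiMeasure_const_mul {r : ℝ} (hr : 0 ≤ r) (S c : ℝ) (m : ℝ → ℝ) :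
    parisiMeasure S (fun t => r * m t) (r * c) = ENNReal.ofReal r • parisiMeasure S m c := by
  unfold parisiMeasure
  rw [smul_add, smul_smul, ← ENNReal.ofReal_mul hr,
    ← withDensity_smul' _ _ ENNReal.ofReal_ne_top]
  congr 2; ext t
  simp [ENNReal.ofReal_mul hr]

/-- Rescaling the parameters rescales `ψ_{β,α}`, up to the contribution of `β₃`. -/
theorem psiCorrected_rescale_le (Ω : Set ℝ) (Q : Measure ℝ) {β β' : InfoParams} {α α' r : ℝ}
    (hr : 0 < r) (h₁ : β.β₁ = r ^ 2 * β'.β₁) (h₂ : β.β₂ = r * β'.β₂) (hα : α = r * α')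
    (S M v : ℝ) :
    (r : EReal) * psiCorrected Ω Q β' α' S M v
        + (((r * β'.β₃ - β.β₃) * S ^ 2 / 4 : ℝ) : EReal)
      ≤ psiCorrected Ω Q β α S M v := by
  unfold psiCorrected
  set q : ℝ := -(β.β₂ * (∫ x₀, x₀ ∂Q) ^ 2 * v ^ 2 / 2) + α * v ^ 2 / 2 with hq
  set q' : ℝ := -(β'.β₂ * (∫ x₀, x₀ ∂Q) ^ 2 * v ^ 2 / 2) + α' * v ^ 2 / 2 with hq'
  -- The finite correction is moved to the left so that the right side is a bare infimum.
  rw [← EReal.sub_le_iff_le_add (.inl (EReal.coe_ne_bot _)) (.inl (EReal.coe_ne_top _))]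
  refine le_sInf ?_
  rintro a ⟨μ, l, ρ, c, m, Φ, hm, hΦ, rfl⟩
  rw [EReal.sub_le_iff_le_add (.inl (EReal.coe_ne_bot _)) (.inl (EReal.coe_ne_top _))]
  have hmem : psiMinus Ω Q β' S M v ≤ _ := sInf_le
    ⟨r⁻¹ * μ, r⁻¹ * l, r⁻¹ * ρ, r * c, fun t => r * m t, fun x₀ t y => r⁻¹ * Φ x₀ t (r * y),
      hm.const_mul hr.le, fun x₀ => by
        have := (h₁ ▸ hΦ x₀).rescale hr
        simpa only [terminalValue_rescale Ω hr] using this, rfl⟩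
  have hr0 : (0 : EReal) ≤ r := by exact_mod_cast hr.le
  refine (add_le_add_left (mul_le_mul_of_nonneg_left (add_le_add_left hmem _) hr0) _).trans ?_
  norm_cast
  apply le_of_eq
  rw [parisiMeasure_const_mul hr.le, integral_smul_measure, ENNReal.toReal_ofReal hr.le,
    integral_const_mul, mul_inv_cancel_left₀ hr.ne', hq, hq', h₁, h₂, hα, smul_eq_mul]
  field_simp
  ring

theorem psiCorrected_rescale (Ω : Set ℝ) (Q : Measure ℝ) {β β' : InfoParams} {α α' r : ℝ}
    (hr : 0 < r) (h₁ : β.β₁ = r ^ 2 * β'.β₁) (h₂ : β.β₂ = r * β'.β₂) (hα : α = r * α')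
    (S M v : ℝ) :
    psiCorrected Ω Q β α S M v = (r : EReal) * psiCorrected Ω Q β' α' S M v
        + (((r * β'.β₃ - β.β₃) * S ^ 2 / 4 : ℝ) : EReal) := by
  have hr0 := hr.ne'
  refine le_antisymm ?_ (psiCorrected_rescale_le Ω Q hr h₁ h₂ hα S M v)
  -- The symmetry is invertible: the reverse bound is the same lemma with `r⁻¹` and the roles
  -- exchanged. Infinite values are treated separately.
  have h := psiCorrected_rescale_le Ω Q (inv_pos.2 hr)
    (show β'.β₁ = r⁻¹ ^ 2 * β.β₁ by rw [h₁]; field_simp)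
    (show β'.β₂ = r⁻¹ * β.β₂ by rw [h₂]; field_simp)
    (show α' = r⁻¹ * α by rw [hα]; field_simp) S M v
  generalize psiCorrected Ω Q β α S M v = x at h ⊢
  generalize psiCorrected Ω Q β' α' S M v = y at h ⊢
  induction x with
  | bot => exact bot_le
  | top =>
    rw [EReal.coe_mul_top_of_pos (inv_pos.2 hr), EReal.top_add_coe, top_le_iff] at h
    rw [h, EReal.coe_mul_top_of_pos hr, EReal.top_add_coe]
  | coe x =>
    induction y with
    | bot =>
      norm_cast at h
    | top => rw [EReal.coe_mul_top_of_pos hr, EReal.top_add_coe]; exact le_top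
    | coe y =>
      norm_cast at h ⊢
      have h' := mul_le_mul_of_nonneg_left h hr.le
      have e : r * (r⁻¹ * x + (r⁻¹ * β.β₃ - β'.β₃) * S ^ 2 / 4)
          = x + (β.β₃ - r * β'.β₃) * S ^ 2 / 4 := by field_simp
      linarith

/-- Since `r` is positive and `k` finite, the affine map fixes `±∞`, so order is preserved at
infinite values of `ψ` too. -/
theorem affine_le_affine_iff {r : ℝ} (hr : 0 < r) (k : ℝ) (x y : EReal) :
    (r : EReal) * x + k ≤ r * y + k ↔ x ≤ y := by
  induction x <;> induction y
  case coe.coe => norm_cast; simp [hr]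
  case coe.bot x =>
    simpa [EReal.coe_mul_bot_of_pos hr] using EReal.coe_ne_bot (r * x)
  case top.coe y => simpa [EReal.coe_mul_top_of_pos hr] using EReal.coe_ne_top (r * y + k)
  all_goals simp [EReal.coe_mul_top_of_pos hr, EReal.coe_mul_bot_of_pos hr]

/-- If every point of `Ω` has modulus `C`, then `S = C²` on `C_-`. -/
theorem fst_eq_of_mem_domainMinus {Ω : Set ℝ} (hΩ : Ω.Nonempty) {Q : Measure ℝ}
    [IsProbabilityMeasure Q] {C : ℝ} (hC : ∀ x ∈ Ω, |x| = C) {p : ℝ × ℝ × ℝ}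
    (hp : p ∈ domainMinus Ω Q) : p.1 = C ^ 2 := by
  -- At `(ρ, τ, η) = (1, 0, 0)` the lower and upper bounds are both `C²`.
  have h := hp 1 (by norm_num) 0 (by norm_num) 0 (by norm_num)
  have him : ∀ x₀ : ℝ, (fun x : ℝ => 1 * x ^ 2 + 0 * x * x₀ + x * 0) '' Ω = {C ^ 2} := by
    intro x₀
    rw [← hΩ.image_const (C ^ 2)]
    refine image_congr fun x hx => ?_
    rw [← hC x hx, sq_abs]; ring
  simp only [him, csInf_singleton, csSup_singleton, integral_const, probReal_univ, one_smul] at h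
  linarith [h.1, h.2]

theorem correctedMaximizers_eq {Ω : Set ℝ} {Q : Measure ℝ} {β β' : InfoParams} {α α' r k : ℝ}
    (hr : 0 < r) (h₁ : β.β₁ = r ^ 2 * β'.β₁) (h₂ : β.β₂ = r * β'.β₂) (hα : α = r * α')
    (h₃ : ∀ p ∈ domainMinus Ω Q, (r * β'.β₃ - β.β₃) * p.1 ^ 2 / 4 = k) :
    correctedMaximizers Ω Q β α = correctedMaximizers Ω Q β' α' := by
  ext p
  refine and_congr_right fun hp => forall₂_congr fun q hq => ?_
  rw [psiCorrected_rescale Ω Q hr h₁ h₂ hα, psiCorrected_rescale Ω Q hr h₁ h₂ hα, h₃ p hp,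
    h₃ q hq, affine_le_affine_iff hr]

theorem InferenceTask.infoParams_β₁_nonneg (T : InferenceTask) : 0 ≤ T.infoParams.β₁ :=
  integral_nonneg fun _ => sq_nonneg _

theorem InferenceTask.infoParams_β₁_eq {T₁ T₂ : InferenceTask} {r : ℝ}
    (h : √T₁.infoParams.β₁ = r * √T₂.infoParams.β₁) :
    T₁.infoParams.β₁ = r ^ 2 * T₂.infoParams.β₁ := by
  rw [← Real.sq_sqrt T₁.infoParams_β₁_nonneg, h, mul_pow, Real.sq_sqrt T₂.infoParams_β₁_nonneg]

end PMLE

end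

theorem mainTheorem9
    (Ω Ω₀ : Set ℝ) (hΩ : IsCompact Ω) (hΩne : Ω.Nonempty) (hΩ₀ : IsCompact Ω₀)
    (Q : MeasureTheory.Measure ℝ) [MeasureTheory.IsProbabilityMeasure Q] (hQ : Q Ω₀ᶜ = 0)
    (T₁ T₂ : PMLE.InferenceTask) (hT₁ : T₁.IllScored) (hT₂ : T₂.IllScored)
    (α₁ α₂ : ℝ)
    (h :
      (∃ r : ℝ, 0 < r ∧
        √T₁.infoParams.β₁ = r * √T₂.infoParams.β₁ ∧
        T₁.infoParams.β₂ = r * T₂.infoParams.β₂ ∧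
        T₁.infoParams.β₃ = r * T₂.infoParams.β₃ ∧
        T₁.infoParams.β₄ = r * T₂.infoParams.β₄ ∧
        α₁ = r * α₂) ∨
      ((∃ C : ℝ, ∀ x ∈ Ω, |x| = C) ∧
        ∃ r : ℝ, 0 < r ∧
          √T₁.infoParams.β₁ = r * √T₂.infoParams.β₁ ∧
          T₁.infoParams.β₂ = r * T₂.infoParams.β₂ ∧
          T₁.infoParams.β₄ = r * T₂.infoParams.β₄ ∧
          α₁ = r * α₂)) :
    PMLE.CoarselyEquivalent Ω Q T₁ α₁ T₂ α₂ := by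
  rcases h with ⟨r, hr, h₁, h₂, h₃, -, hα⟩ | ⟨⟨C, hC⟩, r, hr, h₁, h₂, -, hα⟩
  · exact PMLE.correctedMaximizers_eq (k := 0) hr (PMLE.InferenceTask.infoParams_β₁_eq h₁) h₂ hα
      fun p _ => by rw [h₃]; ring
  -- The constant `k` is found by unification: `(r β₃' - β₃)(C²)²/4`.
  · exact PMLE.correctedMaximizers_eq hr (PMLE.InferenceTask.infoParams_β₁_eq h₁) h₂ hα
      fun p hp => by rw [PMLE.fst_eq_of_mem_domainMinus hΩne hC hp]
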